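/- Let $n,k,d$ be integers with $n\ge 0$ and $k,d\ge 1$. For $A\subseteq[n]$ let $\mathrm{Intersects}_A\colon 2^{[n]}\to\{0,1\}$ be given by $\mathrm{Intersects}_A(S)=1$ if and only if $A\cap S\neq\emptyset$. In the exact gap version of the group testing problem (EGGT) with parameters $k$ and $d$ one is given oracle access to $\mathrm{Intersects}_A$ for some $A$ with $|A|=k$ or $|A|=k+d$, and has to decide which is the case. A quantum algorithm with $T$ queries for this problem acts on a finite-dimensional complex space with orthonormal basis $\{|S,w,b\rangle : S\subseteq[n],\ w\in W,\ b\in\{0,1\}\}$. It applies $U_T\,O_A\,U_{T-1}\,O_A\cdots O_A\,U_0$ to a fixed basis state, where the $U_t$ are arbitrary unitaries independent of $A$ and $O_A|S,w,b\rangle=(-1)^{\mathrm{Intersects}_A(S)}|S,w,b\rangle$, and then measures the last qubit. It solves EGGT if for every $A$ with $|A|\in\{k,k+d\}$ the outcome is, with probability at least $2/3$, equal to $0$ when $|A|=k$ and to $1$ when $|A|=k+d$. **Theorem.** There is an absolute constant $C>0$ such that for all $n\ge0$ and $k,d\ge1$: 1. There is a quantum algorithm that solves EGGT with parameters $k$ and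 $d$ using at most $C\sqrt{1+k/d}$ queries. 2. Let $\mathcal X$ and $\mathcal Y$ be the families of subsets of $[n]$ of size $k$ and $k+d$. There are real vectors $\psi_S\in\mathbb R^{\mathcal X\cup\mathcal Y}$, $S\subseteq[n]$, such that the (positive semidefinite, rank at most one) matrices $X_S=\psi_S\psi_S^{T}$ form a feasible solution of the dual adversary semidefinite program of EGGT, that is, $$\sum_{S:\ \mathrm{Intersects}_A(S)\neq\mathrm{Intersects}_B(S)}X_S[A,B]=1\qquad\text{for all }A\in\mathcal X,\ B\in\mathcal Y,$$ and its objective value satisfies $\sum_{S\subseteq[n]}X_S[A,A]\le C\sqrt{1+k/d}$ for all $A\in\mathcal X\cup\mathcal Y$. -/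

import Mathlib

namespace QuantumQuery

/-- A `T`-query quantum algorithm with oracle access to a Boolean string indexed by `J`.
The state space has the orthonormal basis `J × W × Bool`: a query register, a finite workspace
and an output qubit. The algorithm is `U 0 → O → U 1 → O → ⋯ → O → U T`, started in the basis
state `start`; the unitaries do not depend on the input, and those of index larger than
`T = queries` are not used. -/
structure Algorithm (J : Type) [Fintype J] where
  W : Type
  [fintypeW : Fintype W]
  [decEqW : DecidableEq W]
  queries : ℕ
  start : J × W × Bool
  U : ℕ → (EuclideanSpace ℂ (J × W × Bool) ≃ₗᵢ[ℂ] EuclideanSpace ℂ (J × W × Bool))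

attribute [instance] Algorithm.fintypeW Algorithm.decEqW

/-- The input oracle `O_x = ⨁_j O_{x,j}`, where the block `O_{x,j}` is `I` if `x_j = 0` and
`-I` if `x_j = 1`. -/
def oracle {J W : Type} (x : J → Bool) (v : EuclideanSpace ℂ (J × W × Bool)) :
    EuclideanSpace ℂ (J × W × Bool) :=
  WithLp.toLp 2 fun q => if x q.1 = true then -(v q) else v q

/-- The state of the algorithm on input `x` after `t` oracle calls and the unitary `U t`. -/
noncomputable def Algorithm.state {J : Type} [Fintype J] [DecidableEq J] (𝒜 : Algorithm J)
    (x : J → Bool) : ℕ → EuclideanSpace ℂ (J × 𝒜.W × Bool)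
  | 0 => 𝒜.U 0 (EuclideanSpace.single 𝒜.start 1)
  | t + 1 => 𝒜.U (t + 1) (oracle x (𝒜.state x t))

/-- The probability that measuring the output qubit of the final state gives `b`. -/
noncomputable def Algorithm.outputProb {J : Type} [Fintype J] [DecidableEq J] (𝒜 : Algorithm J)
    (x : J → Bool) (b : Bool) : ℝ :=
  ∑ j : J, ∑ w : 𝒜.W, ‖𝒜.state x 𝒜.queries (j, w, b)‖ ^ 2

/-- A problem is given by a family of inputs `i : ι`, the string `x i` to which the algorithm has
oracle access on input `i`, and the required answer `F i`. The algorithm computes `F` with bounded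
error if on every input it gives the required answer with probability at least `2/3`. -/
def Algorithm.Computes {J ι : Type} [Fintype J] [DecidableEq J] (𝒜 : Algorithm J)
    (x : ι → J → Bool) (F : ι → Bool) : Prop :=
  ∀ i, 2 / 3 ≤ 𝒜.outputProb (x i) (F i)

/-- Feasibility of real matrices `X j` for the dual adversary semidefinite program. -/
def DualAdversaryFeasible {J ι : Type} [Fintype J] (x : ι → J → Bool) (F : ι → Bool)
    (X : J → Matrix ι ι ℝ) : Prop :=
  (∀ j, (X j).PosSemidef) ∧
    ∀ a b, F a ≠ F b → ∑ j with x a j ≠ x b j, X j a b = 1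

/-- The objective value `max_a ∑_j X_j[a, a]` of the dual adversary program is at most `v`. -/
def DualAdversaryObjectiveLE {J ι : Type} [Fintype J] (X : J → Matrix ι ι ℝ) (v : ℝ) : Prop :=
  ∀ a, ∑ j, X j a a ≤ v

end QuantumQuery

namespace GroupTesting

/-- `Intersects_A(S) = 1` iff `A ∩ S` is non-empty. -/
def intersects {n : ℕ} (A S : Finset (Fin n)) : Bool := decide ((A ∩ S).Nonempty)

/-- The inputs of the exact gap version of group testing: the subsets of an `n`-set of size exactly
`k` or exactly `k + d`. -/
abbrev EGGTInput (n k d : ℕ) : Type :=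
  {A : Finset (Fin n) // A.card = k ∨ A.card = k + d}

/-- The oracle string of an input, indexed by all subsets `S`. -/
def eggtOracle (n k d : ℕ) (A : EGGTInput n k d) : Finset (Fin n) → Bool := intersects A.1

/-- The required answer: `1` for the sets of size `k + d`, `0` for those of size `k`. -/
def eggtAnswer (n k d : ℕ) (A : EGGTInput n k d) : Bool := decide (A.1.card = k + d)

end GroupTesting

/-! Let N = n - k - d. The vector `ψ_S` is supported on the sets meeting S in at most one element,
and its entries depend only on |A|, |S| and whether A meets S. For |A| = k, |B| = k + d and e = |A \
B|, the separating S that contribute consist of one element of the symmetric difference and r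
elements outside A ∪ B, so the dual constraint is one identity in the numbers C(N - e, r) for each
e. The weights make it telescope (`sum_weights`): the summand is the difference of consecutive
values of w_r C(N - e, r) / C(N, r), with w falling linearly from 1 to 0, so the total is 1 for
every e. Stopping near r = N / (4d) keeps C(N + d, r) ≤ 2 C(N, r). Splitting each weight evenly
between its two entries makes size r + 1 cost O(√((k + d) / ((N + d)(r + 1)))), which sums to O(√(1
+ k/d)) (`cost_le`). For the algorithm, any rank-one dual solution of value L yields O(L) queries
(`exists_algorithm_of_dualAdversary`): feasibility says that one query changes Gram matrices exactly
as required for a unitary to perform the next step. -/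

namespace QuantumQuery

open scoped InnerProductSpace

/-! ### Unitaries from Gram matrices; basic facts about the oracle. -/

/-- Two families of vectors with the same Gram matrix differ by a unitary. -/
theorem exists_linearIsometryEquiv_of_inner_eq {ι E : Type*} [NormedAddCommGroup E]
    [InnerProductSpace ℂ E] [FiniteDimensional ℂ E] (a b : ι → E)
    (h : ∀ i j, ⟪a i, a j⟫_ℂ = ⟪b i, b j⟫_ℂ) :
    ∃ U : E ≃ₗᵢ[ℂ] E, ∀ i, U (a i) = b i := by
  set f := Finsupp.linearCombination ℂ a with hf
  set g := Finsupp.linearCombination ℂ b with hg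
  have hinner : ∀ l, ⟪f l, f l⟫_ℂ = ⟪g l, g l⟫_ℂ := by
    intro l
    simp only [hf, hg, Finsupp.linearCombination_apply, Finsupp.sum, sum_inner, inner_sum,
      inner_smul_left, inner_smul_right, h]
  have hnorm : ∀ l, ‖f l‖ = ‖g l‖ := by
    intro l
    rw [@norm_eq_sqrt_re_inner ℂ, @norm_eq_sqrt_re_inner ℂ, hinner]
  -- The choice of section is immaterial: by `hnorm`, `g` vanishes on the kernel of `f`.
  obtain ⟨s, hs⟩ := f.rangeRestrict.exists_rightInverse_of_surjective f.range_rangeRestrict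
  have hfs : ∀ y, f (s y) = y := fun y => congrArg Subtype.val (LinearMap.congr_fun hs y)
  let L : LinearMap.range f →ₗᵢ[ℂ] E :=
    { toLinearMap := g ∘ₗ s
      norm_map' := fun y => by
        rw [LinearMap.comp_apply, ← hnorm, hfs]; rfl }
  have hL : ∀ l, L (f.rangeRestrict l) = g l := by
    intro l
    have h0 : g (s (f.rangeRestrict l) - l) = 0 := by
      rw [← norm_eq_zero, ← hnorm, map_sub, hfs]
      simp
    rw [map_sub, sub_eq_zero] at h0
    exact h0
  refine ⟨L.extend.toLinearIsometryEquiv rfl, fun i => ?_⟩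
  have hi : f (Finsupp.single i 1) = a i := by simp [hf]
  have := L.extend_apply (f.rangeRestrict (Finsupp.single i 1))
  rw [hL, LinearMap.codRestrict_apply, hi] at this
  rw [LinearIsometry.coe_toLinearIsometryEquiv, this]
  simp [hg]

theorem oracle_sub {J W : Type} (x : J → Bool) (u v : EuclideanSpace ℂ (J × W × Bool)) :
    oracle x (u - v) = oracle x u - oracle x v := by
  ext r
  simp only [oracle, PiLp.sub_apply]
  split_ifs <;> ring

theorem norm_oracle {J W : Type} [Fintype J] [Fintype W] (x : J → Bool)
    (v : EuclideanSpace ℂ (J × W × Bool)) : ‖oracle x v‖ = ‖v‖ := by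
  rw [EuclideanSpace.norm_eq, EuclideanSpace.norm_eq]
  congr 1
  refine Finset.sum_congr rfl fun r _ => ?_
  simp only [oracle]
  split_ifs <;> simp

variable {J : Type} [DecidableEq J]

/-! ### From rank-one dual solutions to algorithms. -/

/-- The vector with amplitude `p` on the initial basis state, amplitude `q` on the basis state
that carries the answer `f`, and the part `c` in the query register. -/
noncomputable def catalyticState (j₀ : J) (p q : ℝ) (f : Bool) (c : J → Bool → ℝ) :
    EuclideanSpace ℂ (J × Fin 3 × Bool) :=
  WithLp.toLp 2 fun r => ((![if r.1 = j₀ ∧ r.2.2 = false then p else 0,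
    if r.1 = j₀ ∧ r.2.2 = f then q else 0, c r.1 r.2.2] r.2.1 : ℝ) : ℂ)

theorem oracle_catalyticState (j₀ : J) (p q : ℝ) (f : Bool) (c : J → Bool → ℝ) (x : J → Bool)
    (hx : x j₀ = false) :
    oracle x (catalyticState j₀ p q f c) =
      catalyticState j₀ p q f fun j b => if x j = true then -c j b else c j b := by
  ext ⟨j, w, b⟩
  fin_cases w <;> by_cases h : j = j₀ <;> by_cases hj : x j = true <;>
    simp_all [oracle, catalyticState]

variable [Fintype J]

theorem inner_catalyticState (j₀ : J) (p q p' q' : ℝ) (f f' : Bool) (c c' : J → Bool → ℝ) :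
    ⟪catalyticState j₀ p q f c, catalyticState j₀ p' q' f' c'⟫_ℂ =
      ((p * p' + (if f = f' then q * q' else 0) + ∑ j, ∑ b, c j b * c' j b : ℝ) : ℂ) := by
  have hterm : ∀ j, ∑ w : Fin 3, ∑ b : Bool,
      ![if j = j₀ ∧ b = false then p' else 0, if j = j₀ ∧ b = f' then q' else 0, c' j b] w *
        ![if j = j₀ ∧ b = false then p else 0, if j = j₀ ∧ b = f then q else 0, c j b] w =
      (if j = j₀ then p * p' + (if f = f' then q * q' else 0) else 0) +
        ∑ b, c j b * c' j b := by
    intro j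
    rw [Fin.sum_univ_three]
    simp only [Fintype.sum_bool]
    by_cases h : j = j₀ <;> rcases f <;> rcases f' <;> simp [h] <;> ring
  simp only [catalyticState, PiLp.inner_apply, RCLike.inner_apply, Complex.conj_ofReal]
  norm_cast
  simp only [Fintype.sum_prod_type, hterm, Finset.sum_add_distrib, Finset.sum_ite_eq',
    Finset.mem_univ, if_true]

theorem Algorithm.norm_state (𝒜 : Algorithm J) (x : J → Bool) (t : ℕ) : ‖𝒜.state x t‖ = 1 := by
  induction t with
  | zero => simp [Algorithm.state]
  | succ t ih => rw [Algorithm.state, LinearIsometryEquiv.norm_map, norm_oracle, ih]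

theorem Algorithm.outputProb_add_not (𝒜 : Algorithm J) (x : J → Bool) (b : Bool) :
    𝒜.outputProb x b + 𝒜.outputProb x (!b) = 1 := by
  have h := EuclideanSpace.norm_sq_eq (𝒜.state x 𝒜.queries)
  rw [𝒜.norm_state] at h
  simp only [Fintype.sum_prod_type, Fintype.sum_bool, Finset.sum_add_distrib] at h
  cases b <;> simp only [Algorithm.outputProb, Bool.not_true, Bool.not_false] <;> linarith

theorem Algorithm.outputProb_le_norm_sub_sq (𝒜 : Algorithm J) (x : J → Bool) (b : Bool)
    (v : EuclideanSpace ℂ (J × 𝒜.W × Bool)) (hv : ∀ j w, v (j, w, b) = 0) :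
    𝒜.outputProb x b ≤ ‖𝒜.state x 𝒜.queries - v‖ ^ 2 := by
  have h := EuclideanSpace.norm_sq_eq (𝒜.state x 𝒜.queries - v)
  simp only [Fintype.sum_prod_type] at h
  rw [h, Algorithm.outputProb]
  gcongr with j _ w _
  have := Finset.single_le_sum
    (f := fun b => ‖(𝒜.state x 𝒜.queries - v) (j, w, b)‖ ^ 2) (fun _ _ => by positivity)
    (Finset.mem_univ b)
  simpa [hv] using this

/-- A rank-one feasible solution of the dual adversary program with objective value `L` gives a
bounded-error algorithm with `T ≥ 6 L` queries. The part of the state in the query register acts as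
a catalyst: each step `O_x`, `V t` moves a `1 / T` fraction of the squared amplitude from the
initial basis state to the answer and restores the catalyst. -/
theorem exists_algorithm_of_dualAdversary {ι : Type} (x : ι → J → Bool) (F : ι → Bool)
    (j₀ : J) (hx : ∀ i, x i j₀ = false) (ψ : J → ι → ℝ) (L : ℝ)
    (hfeas : DualAdversaryFeasible x F fun j => Matrix.vecMulVec (ψ j) (ψ j))
    (hobj : DualAdversaryObjectiveLE (fun j => Matrix.vecMulVec (ψ j) (ψ j)) L)
    (T : ℕ) (hT : 0 < T) (hLT : 6 * L ≤ T) :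
    ∃ 𝒜 : Algorithm J, 𝒜.Computes x F ∧ 𝒜.queries = T := by
  have hT0 : (0 : ℝ) < T := by exact_mod_cast hT
  let κ : ℝ := √(1 / T)
  have hκ : κ * κ = 1 / T := Real.mul_self_sqrt (by positivity)
  -- The `b = true` half carries the sign (-1)^(F + x). A query therefore lowers the inner product
  -- of inputs i, k at j by κ² ψ_j(i) ψ_j(k) (1 - (-1)^(F i + F k)) (1 - (-1)^(x i j + x k j)) / 4,
  -- which vanishes unless both answers and bits differ.
  let c : ι → J → Bool → ℝ := fun i j b =>
    κ * (bif b && (F i ^^ x i j) then -(ψ j i / 2) else ψ j i / 2)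
  let Φ : ℕ → ι → EuclideanSpace ℂ (J × Fin 3 × Bool) := fun t i =>
    catalyticState j₀ √((T - t) / T) √(t / T) (F i) (c i)
  have hcc : ∀ i k, ∑ j, ∑ b, c i j b * c k j b - ∑ j, ∑ b,
      (if x i j = true then -c i j b else c i j b) * (if x k j = true then -c k j b else c k j b)
      = (if F i = F k then 0 else 1 / T : ℝ) := by
    intro i k
    have hterm : ∀ j, ∑ b, c i j b * c k j b - ∑ b,
        (if x i j = true then -c i j b else c i j b) * (if x k j = true then -c k j b else c k j b)
        = if F i = F k then 0 else 1 / T * (if x i j ≠ x k j then ψ j i * ψ j k else 0) := by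
      intro j
      rw [← hκ]
      simp only [c, Fintype.sum_bool]
      rcases F i <;> rcases F k <;> rcases x i j <;> rcases x k j <;> simp <;> ring
    rw [← Finset.sum_sub_distrib, Finset.sum_congr rfl fun j _ => hterm j]
    split_ifs with hF
    · simp
    · rw [← Finset.mul_sum, ← Finset.sum_filter]
      have := hfeas.2 i k hF
      simp only [Matrix.vecMulVec_apply] at this
      rw [this, mul_one]
  have hnormc : ∀ i, ‖catalyticState j₀ 0 0 (F i) (c i)‖ ^ 2 ≤ L / (2 * T) := by
    intro i
    rw [@norm_sq_eq_re_inner ℂ, inner_catalyticState]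
    have h1 : ∀ j, ∑ b, c i j b * c i j b = 1 / (2 * T) * (ψ j i * ψ j i) := by
      intro j
      have : ∀ s : ℝ, (κ * s) * (κ * s) = 1 / T * (s * s) := fun s => by rw [← hκ]; ring
      simp only [c, Fintype.sum_bool, this]
      rcases F i <;> rcases x i j <;> simp <;> ring
    simp only [h1, ← Finset.mul_sum]
    have := hobj i
    simp only [Matrix.vecMulVec_apply] at this
    simp only [mul_zero, ite_self, zero_add, RCLike.re_to_complex, Complex.ofReal_re]
    calc _ ≤ 1 / (2 * (T : ℝ)) * L := by gcongr
      _ = _ := by ring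
  -- Passing from t to t + 1 lowers the initial-state part of the Gram matrix by 1/T for all pairs
  -- and raises the answer part by 1/T for equal answers. For different answers the drop is made up
  -- by restoring the catalyst, by `hcc`.
  have hV : ∀ t, ∃ U : EuclideanSpace ℂ (J × Fin 3 × Bool) ≃ₗᵢ[ℂ] _,
      t < T → ∀ i, U (oracle (x i) (Φ t i)) = Φ (t + 1) i := by
    intro t
    by_cases ht : t < T
    · have ht' : (t : ℝ) + 1 ≤ T := by exact_mod_cast ht
      obtain ⟨U, hU⟩ := exists_linearIsometryEquiv_of_inner_eq
        (fun i => oracle (x i) (Φ t i)) (fun i => Φ (t + 1) i) (fun i k => by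
          simp only [Φ, oracle_catalyticState _ _ _ _ _ _ (hx _), inner_catalyticState]
          congr 1
          have h1 : (0 : ℝ) ≤ (T - t) / T := div_nonneg (by linarith) hT0.le
          have h2 : (0 : ℝ) ≤ (T - (t + 1 : ℕ)) / T := div_nonneg (by push_cast; linarith) hT0.le
          have h3 : ∀ m : ℕ, (0 : ℝ) ≤ m / T := fun m => by positivity
          simp only [Real.mul_self_sqrt, h1, h2, h3]
          have := hcc i k
          push_cast
          split_ifs at this ⊢ with hF
          · rw [sub_eq_zero] at this
            rw [this]
            field_simp
            ring
          · rw [sub_eq_iff_eq_add] at this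
            rw [this]
            field_simp
            ring)
      exact ⟨U, fun _ => hU⟩
    · exact ⟨LinearIsometryEquiv.refl ℂ _, fun h => absurd h ht⟩
  choose V hV using hV
  let 𝒜 : Algorithm J :=
    { W := Fin 3
      queries := T
      start := (j₀, 0, false)
      U := fun t => t.casesOn (LinearIsometryEquiv.refl ℂ _) V }
  refine ⟨𝒜, fun i => ?_, rfl⟩
  have hsub : ∀ p q, catalyticState j₀ p q (F i) (c i) - catalyticState j₀ 0 0 (F i) (c i) =
      catalyticState j₀ p q (F i) 0 := by
    intro p q
    ext ⟨j, w, b⟩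
    fin_cases w <;> simp [catalyticState]
  have hstart : Φ 0 i - EuclideanSpace.single (j₀, 0, false) 1 =
      catalyticState j₀ 0 0 (F i) (c i) := by
    have : EuclideanSpace.single (j₀, (0 : Fin 3), false) (1 : ℂ) =
        catalyticState j₀ 1 0 (F i) 0 := by
      ext ⟨j, w, b⟩
      fin_cases w <;> simp [catalyticState, Prod.ext_iff]
      split_ifs <;> simp
    rw [this, ← hsub]
    simp [Φ, hT0.ne']
  -- The true run starts without the catalyst; isometries keep this initial error constant.
  have hdist : ∀ t ≤ T, ‖𝒜.state (x i) t - Φ t i‖ =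
      ‖catalyticState j₀ 0 0 (F i) (c i)‖ := by
    intro t
    induction t with
    | zero =>
      intro _
      rw [norm_sub_rev, ← hstart]
      rfl
    | succ t ih =>
      intro ht
      rw [← ih (by omega), ← hV t ht i]
      change ‖V t (oracle (x i) (𝒜.state (x i) t)) - _‖ = _
      rw [← map_sub, LinearIsometryEquiv.norm_map, ← oracle_sub, norm_oracle]
  have hwrong : 𝒜.outputProb (x i) (!(F i)) ≤ 1 / 3 := by
    refine (𝒜.outputProb_le_norm_sub_sq (x i) (!(F i)) (catalyticState j₀ 0 1 (F i) 0)
      fun j w => ?_).trans ?_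
    · change Fin 3 at w
      fin_cases w <;> simp [catalyticState]
    · have h2 : Φ T i - catalyticState j₀ 0 1 (F i) 0 = catalyticState j₀ 0 0 (F i) (c i) := by
        rw [← hsub]
        simp [Φ, hT0.ne']
      -- The catalyst's norm is paid twice, at the start and at the end, so the error probability is
      -- at most 4 · L / (2T); this is where the factor 6 comes from.
      have h3 := norm_add_le (𝒜.state (x i) T - Φ T i) (Φ T i - catalyticState j₀ 0 1 (F i) 0)
      rw [sub_add_sub_cancel, hdist T le_rfl, h2] at h3
      calc _ ≤ (‖catalyticState j₀ 0 0 (F i) (c i)‖ + ‖catalyticState j₀ 0 0 (F i) (c i)‖) ^ 2 := by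
            gcongr
        _ = 4 * ‖catalyticState j₀ 0 0 (F i) (c i)‖ ^ 2 := by ring
        _ ≤ 4 * (L / (2 * T)) := by gcongr; exact hnormc i
        _ ≤ 1 / 3 := by
          rw [mul_div_assoc', div_le_div_iff₀ (by positivity) (by norm_num)]
          linarith
  have := 𝒜.outputProb_add_not (x i) (F i)
  linarith

end QuantumQuery

namespace GroupTesting

/-! ### Counting query sets by intersection pattern. -/

theorem sum_disjoint {α : Type*} [Fintype α] [DecidableEq α] (P : Finset α) (h : ℕ → ℝ) :
    ∑ S : Finset α with (S ∩ P).card = 0, h S.card =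
      ∑ s ∈ Finset.range (Fintype.card α - P.card + 1),
        ((Fintype.card α - P.card).choose s : ℝ) * h s := by
  have : Finset.univ.filter (fun S : Finset α => (S ∩ P).card = 0) = Pᶜ.powerset := by
    ext S
    simp [Finset.subset_compl_iff_disjoint_right, Finset.disjoint_iff_inter_eq_empty]
  rw [this, Finset.sum_powerset_apply_card, Finset.card_compl]
  simp

/-- Such an S is uniquely {q} ∪ R with q ∈ Q \ P and R disjoint from P ∪ Q. -/
theorem sum_disjoint_of_inter_card_eq_one {α : Type*} [Fintype α] [DecidableEq α]
    (P Q : Finset α) (h : ℕ → ℝ) :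
    ∑ S : Finset α with (S ∩ P).card = 0 ∧ (S ∩ Q).card = 1, h S.card =
      (Q \ P).card * ∑ r ∈ Finset.range (Fintype.card α - (P ∪ Q).card + 1),
        ((Fintype.card α - (P ∪ Q).card).choose r : ℝ) * h (r + 1) := by
  have key : ∑ x ∈ (Q \ P) ×ˢ (P ∪ Q)ᶜ.powerset, h (x.2.card + 1) =
      ∑ S : Finset α with (S ∩ P).card = 0 ∧ (S ∩ Q).card = 1, h S.card := by
    refine Finset.sum_nbij (fun x => insert x.1 x.2) ?_ ?_ ?_ ?_
    · rintro ⟨q, R⟩ hx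
      simp only [Finset.mem_product, Finset.mem_sdiff, Finset.mem_powerset,
        Finset.subset_iff, Finset.mem_compl, Finset.mem_union] at hx
      simp only [Finset.mem_filter, Finset.mem_univ, true_and, Finset.card_eq_zero,
        Finset.card_eq_one]
      refine ⟨by ext i; simp; grind, q, by ext i; simp; grind⟩
    · rintro ⟨q, R⟩ hx ⟨q', R'⟩ hx' heq
      simp only [Finset.coe_product, Set.mem_prod, Finset.mem_coe, Finset.mem_sdiff,
        Finset.mem_powerset, Finset.subset_iff, Finset.mem_compl, Finset.mem_union] at hx hx'
      simp only [Finset.ext_iff, Finset.mem_insert] at heq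
      have h1 : q = q' := by grind
      refine Prod.ext h1 (Finset.ext fun i => ?_)
      have := heq i
      grind
    · intro S hS
      simp only [Finset.coe_filter, Finset.mem_univ, true_and, Finset.card_eq_zero,
        Finset.card_eq_one, Set.mem_ofPred_eq] at hS
      obtain ⟨hP, q, hq⟩ := hS
      simp only [Finset.ext_iff, Finset.mem_inter, Finset.mem_singleton] at hP hq
      refine ⟨(q, S.erase q), ?_, Finset.insert_erase (by grind)⟩
      simp only [Finset.coe_product, Set.mem_prod, Finset.mem_coe, Finset.mem_sdiff,
        Finset.mem_powerset, Finset.subset_iff, Finset.mem_compl, Finset.mem_union]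
      grind
    · rintro ⟨q, R⟩ hx
      simp only [Finset.mem_product, Finset.mem_sdiff, Finset.mem_powerset,
        Finset.subset_iff, Finset.mem_compl, Finset.mem_union] at hx
      rw [Finset.card_insert_of_notMem (by grind)]
  rw [← key, Finset.sum_product]
  simp only [Finset.sum_const, nsmul_eq_mul]
  rw [Finset.sum_powerset_apply_card (fun m => h (m + 1)), Finset.card_compl]
  simp

/-- The vector `ψ_S` with entry `a |S|` at the sets `A` disjoint from `S` and entry `y |A| |S|` at
the sets `A` that meet `S` in one element. -/
def hitVector {n k d : ℕ} (a : ℕ → ℝ) (y : ℕ → ℕ → ℝ) (S : Finset (Fin n))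
    (A : EGGTInput n k d) : ℝ :=
  if (S ∩ A.1).card = 0 then a S.card
  else if (S ∩ A.1).card = 1 then y A.1.card S.card else 0

theorem intersects_eq_false_iff {n : ℕ} (A S : Finset (Fin n)) :
    intersects A S = false ↔ (S ∩ A).card = 0 := by
  rw [Finset.inter_comm, intersects, decide_eq_false_iff_not, Finset.not_nonempty_iff_eq_empty,
    Finset.card_eq_zero]

theorem sum_sq_hitVector {n k d : ℕ} (a : ℕ → ℝ) (y : ℕ → ℕ → ℝ) (A : EGGTInput n k d)
    (ha : a 0 = 0) :
    ∑ S, hitVector a y S A * hitVector a y S A =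
      ∑ r ∈ Finset.range (n - A.1.card), ((n - A.1.card).choose (r + 1) : ℝ) * a (r + 1) ^ 2 +
      A.1.card * ∑ r ∈ Finset.range (n - A.1.card + 1),
        ((n - A.1.card).choose r : ℝ) * y A.1.card (r + 1) ^ 2 := by
  have h0 := sum_disjoint A.1 fun s => a s ^ 2
  have h1 := sum_disjoint_of_inter_card_eq_one ∅ A.1 fun s => y A.1.card s ^ 2
  rw [Finset.sum_range_succ'] at h0
  simp only [Finset.inter_empty, Finset.card_empty, true_and, Finset.sdiff_empty,
    Finset.empty_union, Fintype.card_fin, ha] at h0 h1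
  rw [← h1]
  rw [zero_pow two_ne_zero, mul_zero, add_zero] at h0
  rw [← h0, Finset.sum_filter, Finset.sum_filter, ← Finset.sum_add_distrib]
  refine Finset.sum_congr rfl fun S _ => ?_
  unfold hitVector
  generalize (S ∩ A.1).card = i
  split_ifs <;> first | omega | ring

/-- A separating S misses one of the two sets, and contributes only if it meets the other in a
single element. -/
theorem sum_hitVector_mul {n k d : ℕ} (a : ℕ → ℝ) (y : ℕ → ℕ → ℝ) (A B : EGGTInput n k d) :
    ∑ S with intersects A.1 S ≠ intersects B.1 S, hitVector a y S A * hitVector a y S B =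
      (B.1 \ A.1).card * ∑ r ∈ Finset.range (n - (A.1 ∪ B.1).card + 1),
        ((n - (A.1 ∪ B.1).card).choose r : ℝ) * (a (r + 1) * y B.1.card (r + 1)) +
      (A.1 \ B.1).card * ∑ r ∈ Finset.range (n - (A.1 ∪ B.1).card + 1),
        ((n - (A.1 ∪ B.1).card).choose r : ℝ) * (a (r + 1) * y A.1.card (r + 1)) := by
  have h1 := sum_disjoint_of_inter_card_eq_one A.1 B.1 fun s => a s * y B.1.card s
  have h2 := sum_disjoint_of_inter_card_eq_one B.1 A.1 fun s => a s * y A.1.card s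
  rw [Finset.union_comm] at h2
  simp only [Fintype.card_fin] at h1 h2
  rw [← h1, ← h2]
  simp only [Finset.sum_filter, ← Finset.sum_add_distrib]
  refine Finset.sum_congr rfl fun S _ => ?_
  have hA := intersects_eq_false_iff A.1 S
  have hB := intersects_eq_false_iff B.1 S
  unfold hitVector
  generalize intersects A.1 S = u at *
  generalize intersects B.1 S = v at *
  generalize (S ∩ A.1).card = i at *
  generalize (S ∩ B.1).card = j at *
  rcases u <;> rcases v <;> simp_all
  split_ifs <;> simp_all [mul_comm]

/-! ### Binomial estimates. -/

/-- A Bernoulli inequality: C(N, r) / C(N + d, r) is the product over i < r of 1 - d / (N + d - i),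
and each subtracted term is at most 2d / N. -/
theorem sub_mul_choose_add_le (N d r : ℕ) (hr : 2 * r ≤ N) :
    ((N : ℝ) - 2 * r * d) * ((N + d).choose r : ℝ) ≤ N * (N.choose r : ℝ) := by
  induction r with
  | zero => simp
  | succ r ih =>
    have ih := ih (by omega)
    have h1 : ((N.choose (r + 1) : ℕ) : ℝ) * (r + 1) = N.choose r * (N - r) := by
      rw [← Nat.cast_sub (by omega)]
      exact_mod_cast Nat.choose_succ_right_eq N r
    have h2 : (((N + d).choose (r + 1) : ℕ) : ℝ) * (r + 1) = (N + d).choose r * (N + d - r) := by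
      rw [← Nat.cast_add, ← Nat.cast_sub (by omega)]
      exact_mod_cast Nat.choose_succ_right_eq (N + d) r
    have hr' : 2 * ((r : ℝ) + 1) ≤ N := by exact_mod_cast hr
    have hr0 : (0 : ℝ) ≤ r := r.cast_nonneg
    have hd0 : (0 : ℝ) ≤ d := d.cast_nonneg
    have hc : (0 : ℝ) ≤ (N + d).choose r := Nat.cast_nonneg _
    refine le_of_mul_le_mul_right ?_ (by positivity : (0 : ℝ) < r + 1)
    rw [mul_assoc, h2, mul_assoc (N : ℝ), h1]
    push_cast
    have h3 : ((N : ℝ) - 2 * (r + 1) * d) * (N + d - r) ≤ (N - 2 * r * d) * (N - r) := by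
      nlinarith [mul_nonneg hd0 hr0, mul_nonneg hd0 hd0, mul_nonneg (mul_nonneg hd0 hd0) hr0,
        mul_nonneg hd0 (by linarith : (0 : ℝ) ≤ N - 2 * (r + 1))]
    calc _ = ((N : ℝ) - 2 * (r + 1) * d) * (N + d - r) * (N + d).choose r := by ring
      _ ≤ (N - 2 * r * d) * (N - r) * (N + d).choose r := by gcongr
      _ = (N - r) * ((N - 2 * r * d) * (N + d).choose r) := by ring
      _ ≤ (N - r) * (N * N.choose r) := by
        gcongr
        linarith
      _ = _ := by ring

theorem choose_add_le_two_mul (N d r : ℕ) (hd : 1 ≤ d) (h : 4 * d * r ≤ N) :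
    ((N + d).choose r : ℝ) ≤ 2 * N.choose r := by
  rcases Nat.eq_zero_or_pos N with rfl | hN
  · have : r = 0 := by
      simpa [show d ≠ 0 by omega] using h
    subst this
    simp
  have h1 := sub_mul_choose_add_le N d r (by nlinarith)
  have hN0 : (0 : ℝ) < N := by exact_mod_cast hN
  have h' : 4 * (d : ℝ) * r ≤ N := by exact_mod_cast h
  have hc : (0 : ℝ) ≤ (N + d).choose r := Nat.cast_nonneg _
  refine le_of_mul_le_mul_left ?_ hN0
  nlinarith

theorem choose_add_succ_le (N d r : ℕ) (hd : 1 ≤ d) (h : 4 * d * r ≤ N) :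
    ((N + d).choose (r + 1) : ℝ) ≤ 2 * ((N + d) / (r + 1)) * N.choose r := by
  have h2 : (((N + d).choose (r + 1) : ℕ) : ℝ) * (r + 1) = (N + d).choose r * (N + d - r) := by
    rw [← Nat.cast_add, ← Nat.cast_sub (by nlinarith)]
    exact_mod_cast Nat.choose_succ_right_eq (N + d) r
  have h3 := choose_add_le_two_mul N d r hd h
  have hr0 : (0 : ℝ) ≤ r := r.cast_nonneg
  have hc : (0 : ℝ) ≤ (N + d).choose r := Nat.cast_nonneg _
  have hNd : (0 : ℝ) ≤ (N : ℝ) + d := by positivity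
  rw [mul_div_assoc', div_mul_eq_mul_div, le_div_iff₀ (by positivity), h2]
  calc _ ≤ ((N + d).choose r : ℝ) * (N + d) := by gcongr; linarith
    _ ≤ 2 * N.choose r * (N + d) := by gcongr
    _ = _ := by ring

theorem sum_inv_sqrt_le (M : ℕ) :
    ∑ r ∈ Finset.range M, 1 / √((r : ℝ) + 1) ≤ 2 * √(M : ℝ) := by
  induction M with
  | zero => simp
  | succ m ih =>
    rw [Finset.sum_range_succ]
    have h0 : (0 : ℝ) ≤ m := m.cast_nonneg
    have h1 := Real.sq_sqrt h0
    have h2 := Real.sq_sqrt (by linarith : (0 : ℝ) ≤ (m : ℝ) + 1)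
    have h3 : 0 < √((m : ℝ) + 1) := Real.sqrt_pos.2 (by linarith)
    have h4 : 1 / √((m : ℝ) + 1) ≤ 2 * √((m : ℝ) + 1) - 2 * √m := by
      rw [div_le_iff₀ h3]
      nlinarith [sq_nonneg (√((m : ℝ) + 1) - √m)]
    push_cast
    linarith

/-! ### The weights and the telescoping identity. -/

/-- The number of sizes of query sets in the support of the dual solution. -/
def cutoff (N d : ℕ) : ℕ := N / (4 * d) + 1

theorem mul_le_of_lt_cutoff {N d r : ℕ} (hr : r < cutoff N d) : 4 * d * r ≤ N := by
  unfold cutoff at hr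
  calc _ ≤ 4 * d * (N / (4 * d)) := by gcongr; omega
    _ ≤ N := Nat.mul_div_le _ _

theorem add_le_mul_cutoff {N d : ℕ} (hd : 1 ≤ d) : N + d ≤ 5 * (cutoff N d * d) := by
  have h := Nat.lt_mul_div_succ N (by omega : 0 < 4 * d)
  unfold cutoff
  nlinarith [Nat.zero_le (N / (4 * d) * d)]

theorem mul_cutoff_le (N d : ℕ) : cutoff N d * d ≤ N + d := by
  have h := Nat.mul_div_le N (4 * d)
  unfold cutoff
  nlinarith [Nat.zero_le (N / (4 * d) * d)]

/-- The decreasing weight that the telescoping sum starts from. -/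
noncomputable def ramp (N d r : ℕ) : ℝ := if r < cutoff N d then 1 - r / cutoff N d else 0

/-- The product of the two entries of `ψ_S`, `|S| = r + 1`, for the pairs in which the larger set
meets `S`. -/
noncomputable def upWeight (N d r : ℕ) : ℝ :=
  if r < cutoff N d then 1 / (cutoff N d * d * N.choose r) else 0

/-- The product of the two entries of `ψ_S`, `|S| = r + 1`, for the pairs in which the smaller set
meets `S`. -/
noncomputable def downWeight (N d r : ℕ) : ℝ :=
  ramp N d (r + 1) / ((N - r) * N.choose r) - upWeight N d r

theorem ramp_nonneg (N d r : ℕ) : 0 ≤ ramp N d r := by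
  unfold ramp
  split_ifs with h
  · rw [sub_nonneg]
    exact div_le_one_of_le₀ (by exact_mod_cast h.le) (Nat.cast_nonneg _)
  · exact le_rfl

theorem ramp_le_one (N d r : ℕ) : ramp N d r ≤ 1 := by
  unfold ramp
  split_ifs with h
  · rw [sub_le_self_iff]
    positivity
  · exact zero_le_one

theorem ramp_sub_ramp_succ {N d r : ℕ} (hr : r < cutoff N d) :
    ramp N d r - ramp N d (r + 1) = 1 / cutoff N d := by
  have hM : (cutoff N d : ℝ) ≠ 0 := by
    have : 0 < cutoff N d := by omega
    positivity
  unfold ramp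
  rw [if_pos hr]
  split_ifs with h
  · push_cast
    ring
  · have : cutoff N d = r + 1 := by omega
    rw [this] at hM ⊢
    push_cast at hM ⊢
    field_simp
    ring

/-- Here e = |A \ B| and e + d = |B \ A|. The d-part supplies the drop of `ramp`; the e-part, where
`upWeight` cancels, supplies the drop of C(N - e, r) / C(N, r), whose relative size is e / (N - r).
-/
theorem sum_weights {N d : ℕ} (hd : 1 ≤ d) (e : ℕ) (he : e ≤ N) :
    ((e + d : ℕ) : ℝ) * ∑ r ∈ Finset.range (N - e + 1), ((N - e).choose r : ℝ) * upWeight N d r +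
      e * ∑ r ∈ Finset.range (N - e + 1), ((N - e).choose r : ℝ) * downWeight N d r = 1 := by
  have hterm : ∀ r ∈ Finset.range (N - e + 1),
      ((e + d : ℕ) : ℝ) * (((N - e).choose r : ℝ) * upWeight N d r) +
        e * (((N - e).choose r : ℝ) * downWeight N d r) =
      ramp N d r * ((N - e).choose r / N.choose r) -
        ramp N d (r + 1) * ((N - e).choose (r + 1) / N.choose (r + 1)) := by
    intro r hr
    have hr : r ≤ N - e := by simpa [Nat.lt_succ_iff] using hr
    have hd0 : (d : ℝ) ≠ 0 := by positivity
    have hK : (N.choose r : ℝ) ≠ 0 := by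
      exact_mod_cast (Nat.choose_pos (by omega)).ne'
    by_cases hM : r < cutoff N d
    · have hM0 : (cutoff N d : ℝ) ≠ 0 := by
        have : 0 < cutoff N d := by omega
        positivity
      have hup : (d : ℝ) * upWeight N d r = (ramp N d r - ramp N d (r + 1)) / N.choose r := by
        rw [ramp_sub_ramp_succ hM, upWeight, if_pos hM]
        field_simp
      have hdown : (e : ℝ) * ((N - e).choose r : ℝ) * (ramp N d (r + 1) / ((N - r) * N.choose r)) =
          ramp N d (r + 1) * ((N - e).choose r / N.choose r) -
            ramp N d (r + 1) * ((N - e).choose (r + 1) / N.choose (r + 1)) := by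
        -- At the last size N - r can be zero (when N = 0), but there the factor `ramp N d (r + 1)`
        -- is zero.
        by_cases hM' : r + 1 < cutoff N d
        · have hlt : r < N := by
            have := mul_le_of_lt_cutoff hM'
            nlinarith
          have h1 : ((N.choose (r + 1) : ℕ) : ℝ) * (r + 1) = N.choose r * (N - r) := by
            rw [← Nat.cast_sub hlt.le]
            exact_mod_cast Nat.choose_succ_right_eq N r
          have h2 : (((N - e).choose (r + 1) : ℕ) : ℝ) * (r + 1) =
              (N - e).choose r * (N - e - r) := by
            rw [← Nat.cast_sub he, ← Nat.cast_sub hr]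
            exact_mod_cast Nat.choose_succ_right_eq (N - e) r
          have h3 : (N : ℝ) - r ≠ 0 := by
            rw [sub_ne_zero]
            exact_mod_cast hlt.ne'
          have h4 : (r : ℝ) + 1 ≠ 0 := by positivity
          rw [eq_div_of_mul_eq h4 h1, eq_div_of_mul_eq h4 h2]
          field_simp
          ring
        · have : ramp N d (r + 1) = 0 := if_neg hM'
          simp [this]
      calc _ = ((N - e).choose r : ℝ) * (d * upWeight N d r) + e * ((N - e).choose r : ℝ) *
            (ramp N d (r + 1) / ((N - r) * N.choose r)) := by
            rw [downWeight]
            push_cast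
            ring
        _ = _ := by
            rw [hup, hdown]
            ring
    · have h1 : ramp N d r = 0 := if_neg hM
      have h2 : ramp N d (r + 1) = 0 := if_neg (by omega)
      simp [upWeight, downWeight, hM, h1, h2]
  -- The upper boundary term dies because C(N - e, N - e + 1) = 0; the lower one is `ramp N d 0` =
  -- 1.
  rw [Finset.mul_sum, Finset.mul_sum, ← Finset.sum_add_distrib, Finset.sum_congr rfl hterm,
    Finset.sum_range_sub']
  simp [ramp, cutoff]

theorem upWeight_nonneg (N d r : ℕ) : 0 ≤ upWeight N d r := by
  unfold upWeight
  split_ifs <;> positivity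

theorem choose_pos_of_lt_cutoff {N d r : ℕ} (hd : 1 ≤ d) (hr : r < cutoff N d) :
    (0 : ℝ) < N.choose r := by
  have := mul_le_of_lt_cutoff hr
  exact_mod_cast Nat.choose_pos (by nlinarith)

theorem upWeight_le {N d r : ℕ} (hd : 1 ≤ d) (hr : r < cutoff N d) :
    upWeight N d r ≤ 5 / ((N + d) * N.choose r) := by
  have hK := choose_pos_of_lt_cutoff hd hr
  have h : (N : ℝ) + d ≤ 5 * (cutoff N d * d) := by exact_mod_cast add_le_mul_cutoff hd
  have hd0 : (0 : ℝ) < d := by exact_mod_cast hd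
  have hM : (0 : ℝ) < cutoff N d := by exact_mod_cast (by omega : 0 < cutoff N d)
  rw [upWeight, if_pos hr, div_le_div_iff₀ (by positivity) (by positivity)]
  nlinarith

/-- A difference of two nonnegative terms, each within the bound. It may be negative, which is
harmless: its sign goes into one entry of `ψ_S`. -/
theorem abs_downWeight_le {N d r : ℕ} (hd : 1 ≤ d) (hr : r < cutoff N d) :
    |downWeight N d r| ≤ 5 / ((N + d) * N.choose r) := by
  have hK := choose_pos_of_lt_cutoff hd hr
  have hd0 : (0 : ℝ) < d := by exact_mod_cast hd
  have h1 := upWeight_nonneg N d r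
  have h2 := upWeight_le hd hr
  have h3 : 0 ≤ ramp N d (r + 1) / ((N - r) * N.choose r) ∧
      ramp N d (r + 1) / ((N - r) * N.choose r) ≤ 5 / ((N + d) * N.choose r) := by
    by_cases hM' : r + 1 < cutoff N d
    · have hN : 4 * (d : ℝ) * (r + 1) ≤ N := by exact_mod_cast mul_le_of_lt_cutoff hM'
      have hd1 : (1 : ℝ) ≤ d := by exact_mod_cast hd
      have hr0 : (0 : ℝ) ≤ r := r.cast_nonneg
      have hNr : (N : ℝ) + d ≤ 5 * (N - r) := by nlinarith
      have hNr' : (0 : ℝ) < N - r := by nlinarith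
      have hr1 := ramp_le_one N d (r + 1)
      have hr2 := ramp_nonneg N d (r + 1)
      refine ⟨by positivity, ?_⟩
      calc _ ≤ 1 / (((N : ℝ) - r) * N.choose r) := by gcongr
        _ ≤ _ := by
          rw [div_le_div_iff₀ (by positivity) (by positivity)]
          nlinarith
    · have : ramp N d (r + 1) = 0 := if_neg hM'
      rw [this, zero_div]
      exact ⟨le_rfl, by positivity⟩
  rw [downWeight, abs_le]
  constructor <;> linarith

/-! ### The objective value and the dual solution. -/

/-- The entry of `ψ_S`, `|S| = r + 1`, at the sets disjoint from `S`. -/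
noncomputable def missEntry (N k d r : ℕ) : ℝ :=
  if r < cutoff N d then
    √(√((k + d) / (N + d)) / √(r + 1) * (r + 1) / ((N + d) * N.choose r)) else 0

theorem missEntry_pos {N k d r : ℕ} (hd : 1 ≤ d) (hr : r < cutoff N d) :
    0 < missEntry N k d r := by
  have hK := choose_pos_of_lt_cutoff hd hr
  rw [missEntry, if_pos hr]
  positivity

/-- Used with m = |A| and p = n - |A|. `missEntry` balances the two sums: both have terms of order D
/ √(r + 1), with constants 2 and 50 = 2 · 5². Summing 1 / √(r + 1) doubles 52 to 104. -/
theorem cost_le {N k d : ℕ} (hd : 1 ≤ d) (v : ℕ → ℝ)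
    (hv : ∀ r < cutoff N d, |v r| ≤ 5 / ((N + d) * N.choose r))
    (p m : ℕ) (hp : p ≤ N + d) (hm : m ≤ k + d) :
    ∑ r ∈ Finset.range p, (p.choose (r + 1) : ℝ) * missEntry N k d r ^ 2 +
      m * ∑ r ∈ Finset.range (p + 1), (p.choose r : ℝ) * (v r / missEntry N k d r) ^ 2 ≤
    104 * √(1 + k / d) := by
  set D : ℝ := √((k + d) / (N + d)) with hD
  have hd0 : (0 : ℝ) < d := by exact_mod_cast hd
  have hD0 : 0 < D := by positivity
  have hDD : D * D = (k + d) / (N + d) := Real.mul_self_sqrt (by positivity)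
  have hmiss : ∀ r, (p.choose (r + 1) : ℝ) * missEntry N k d r ^ 2 ≤
      if r < cutoff N d then 2 * (D * (1 / √((r : ℝ) + 1))) else 0 := by
    intro r
    split_ifs with hr
    · have hK := choose_pos_of_lt_cutoff hd hr
      rw [missEntry, if_pos hr, Real.sq_sqrt (by positivity), ← hD]
      calc _ ≤ ((N + d).choose (r + 1) : ℝ) *
            (D / √((r : ℝ) + 1) * (r + 1) / ((N + d) * N.choose r)) := by
            gcongr
        _ ≤ 2 * ((N + d) / (r + 1)) * N.choose r *
            (D / √((r : ℝ) + 1) * (r + 1) / ((N + d) * N.choose r)) := by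
            gcongr
            exact choose_add_succ_le N d r hd (mul_le_of_lt_cutoff hr)
        _ = _ := by field_simp
    · simp [missEntry, hr]
  have hhit : ∀ r, (m : ℝ) * ((p.choose r : ℝ) * (v r / missEntry N k d r) ^ 2) ≤
      if r < cutoff N d then 50 * (D * (1 / √((r : ℝ) + 1))) else 0 := by
    intro r
    split_ifs with hr
    · have hK := choose_pos_of_lt_cutoff hd hr
      have hm' : (m : ℝ) ≤ k + d := by exact_mod_cast hm
      have hv2 : v r ^ 2 ≤ (5 / ((N + d) * N.choose r)) ^ 2 := sq_le_sq' (by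
        linarith [neg_abs_le (v r), hv r hr]) ((le_abs_self _).trans (hv r hr))
      have hs : √((r : ℝ) + 1) * √((r : ℝ) + 1) = r + 1 := Real.mul_self_sqrt (by positivity)
      rw [div_pow, missEntry, if_pos hr, Real.sq_sqrt (by positivity), ← hD]
      calc _ ≤ ((k : ℝ) + d) * (((N + d).choose r : ℝ) * ((5 / ((N + d) * N.choose r)) ^ 2 /
            (D / √((r : ℝ) + 1) * (r + 1) / ((N + d) * N.choose r)))) := by
            gcongr
        _ ≤ ((k : ℝ) + d) * ((2 * N.choose r) * ((5 / ((N + d) * N.choose r)) ^ 2 /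
            (D / √((r : ℝ) + 1) * (r + 1) / ((N + d) * N.choose r)))) := by
            gcongr
            exact choose_add_le_two_mul N d r hd (mul_le_of_lt_cutoff hr)
        _ = 50 * ((k + d) / (N + d)) / (D * √((r : ℝ) + 1)) := by
            have hw : 0 < √((r : ℝ) + 1) := by positivity
            generalize √((r : ℝ) + 1) = w at hs hw ⊢
            rw [← hs]
            field_simp
            ring
        _ = _ := by
            rw [← hDD]
            field_simp
    · simp [missEntry, hr]
  have hsum : ∀ (q : ℕ) (c : ℝ), 0 ≤ c →
      ∑ r ∈ Finset.range q, (if r < cutoff N d then c * (D * (1 / √((r : ℝ) + 1))) else 0) ≤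
        c * (D * (2 * √(cutoff N d : ℝ))) := by
    intro q c hc
    rw [← Finset.sum_filter]
    calc _ ≤ ∑ r ∈ Finset.range (cutoff N d), c * (D * (1 / √((r : ℝ) + 1))) := by
          refine Finset.sum_le_sum_of_subset_of_nonneg (fun r hr => ?_) fun _ _ _ => by positivity
          simpa using (Finset.mem_filter.1 hr).2
      _ = c * (D * ∑ r ∈ Finset.range (cutoff N d), 1 / √((r : ℝ) + 1)) := by
          rw [← Finset.mul_sum, ← Finset.mul_sum]
      _ ≤ _ := by
          gcongr
          exact sum_inv_sqrt_le _
  have hfin : D * √(cutoff N d : ℝ) ≤ √(1 + k / d) := by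
    rw [hD, ← Real.sqrt_mul (by positivity)]
    refine Real.sqrt_le_sqrt ?_
    have h : (cutoff N d : ℝ) * d ≤ N + d := by exact_mod_cast mul_cutoff_le N d
    calc _ ≤ ((k : ℝ) + d) / (N + d) * ((N + d) / d) := by
          gcongr
          rwa [le_div_iff₀ hd0]
      _ = _ := by
          field_simp
          ring
  calc _ ≤ 2 * (D * (2 * √(cutoff N d : ℝ))) + 50 * (D * (2 * √(cutoff N d : ℝ))) := by
        rw [Finset.mul_sum]
        exact add_le_add ((Finset.sum_le_sum fun r _ => hmiss r).trans (hsum _ _ (by norm_num)))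
          ((Finset.sum_le_sum fun r _ => hhit r).trans (hsum _ _ (by norm_num)))
    _ = 104 * (D * √(cutoff N d : ℝ)) := by ring
    _ ≤ _ := by gcongr

theorem exists_dualAdversary_solution (n k d : ℕ) (hd : 1 ≤ d) :
    ∃ ψ : Finset (Fin n) → EGGTInput n k d → ℝ,
      QuantumQuery.DualAdversaryFeasible (eggtOracle n k d) (eggtAnswer n k d)
        (fun S => Matrix.vecMulVec (ψ S) (ψ S)) ∧
      QuantumQuery.DualAdversaryObjectiveLE (fun S => Matrix.vecMulVec (ψ S) (ψ S))
        (104 * √(1 + k / d)) := by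
  have hpsd : ∀ w : EGGTInput n k d → ℝ, (Matrix.vecMulVec w w).PosSemidef := fun w => by
    simpa using Matrix.posSemidef_vecMulVec_self_star w
  -- With no set of size k + d the constraints are vacuous.
  by_cases hn : n < k + d
  · refine ⟨0, ⟨fun S => hpsd _, fun A B hAB => ?_⟩, fun A => ?_⟩
    · have hA := A.1.card_le_univ
      have hB := B.1.card_le_univ
      rw [Fintype.card_fin] at hA hB
      simp only [eggtAnswer] at hAB
      rw [decide_eq_false (by omega), decide_eq_false (by omega)] at hAB
      exact absurd rfl hAB
    · simp [Matrix.vecMulVec_apply]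
  obtain ⟨N, rfl⟩ : ∃ N, n = N + d + k := ⟨n - (k + d), by omega⟩
  let a : ℕ → ℝ := fun s => s.casesOn 0 (missEntry N k d)
  let v : ℕ → ℕ → ℝ := fun m => if m = k then downWeight N d else upWeight N d
  let y : ℕ → ℕ → ℝ := fun m s => v m (s - 1) / missEntry N k d (s - 1)
  have hay : ∀ m r, a (r + 1) * y m (r + 1) = v m r := by
    intro m r
    change missEntry N k d r * (v m r / missEntry N k d r) = v m r
    by_cases hr : r < cutoff N d
    · exact mul_div_cancel₀ _ (missEntry_pos hd hr).ne'
    · have h1 : missEntry N k d r = 0 := if_neg hr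
      have h2 : ramp N d (r + 1) = 0 := if_neg (by omega)
      have h3 : upWeight N d r = 0 := if_neg hr
      simp only [v, h1]
      split_ifs <;> simp [downWeight, h2, h3]
  have hfeas : ∀ A B : EGGTInput (N + d + k) k d, A.1.card = k → B.1.card = k + d →
      ∑ S with intersects A.1 S ≠ intersects B.1 S, hitVector a y S A * hitVector a y S B = 1 := by
    intro A B hA hB
    rw [sum_hitVector_mul]
    have h1 := Finset.card_sdiff_add_card_inter A.1 B.1
    have h2 := Finset.card_sdiff_add_card_inter B.1 A.1
    have h3 := Finset.card_union_add_card_inter A.1 B.1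
    have h4 := (A.1 ∪ B.1).card_le_univ
    rw [Finset.inter_comm] at h2
    rw [Fintype.card_fin] at h4
    have h5 : (B.1 \ A.1).card = (A.1 \ B.1).card + d := by omega
    have h6 : N + d + k - (A.1 ∪ B.1).card = N - (A.1 \ B.1).card := by omega
    simp only [hay, h5, h6]
    have := sum_weights hd (A.1 \ B.1).card (by omega : _ ≤ N)
    simpa [v, hA, hB, show d ≠ 0 by omega] using this
  refine ⟨hitVector a y, ⟨fun S => hpsd _, fun A B hAB => ?_⟩, fun A => ?_⟩
  · simp only [Matrix.vecMulVec_apply, eggtOracle]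
    simp only [eggtAnswer, ne_eq, decide_eq_decide] at hAB
    rcases A.2 with hA | hA
    · exact hfeas A B hA (by omega)
    · exact (Finset.sum_congr (Finset.filter_congr fun S _ => ne_comm)
        fun S _ => mul_comm _ _).trans (hfeas B A (by have := B.2; omega) hA)
  · simp only [Matrix.vecMulVec_apply]
    rw [sum_sq_hitVector a y A rfl]
    have hA := A.2
    refine cost_le hd (v A.1.card) (fun r hr => ?_) _ _ (by omega) (by omega)
    simp only [v]
    split_ifs
    · exact abs_downWeight_le hd hr
    · rw [abs_of_nonneg (upWeight_nonneg N d r)]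
      exact upWeight_le hd hr

end GroupTesting

theorem mainTheorem3 :
    ∃ C : ℝ, 0 < C ∧ ∀ n k d : ℕ, 1 ≤ k → 1 ≤ d →
      (∃ 𝒜 : QuantumQuery.Algorithm (Finset (Fin n)),
        𝒜.Computes (GroupTesting.eggtOracle n k d) (GroupTesting.eggtAnswer n k d) ∧
        (𝒜.queries : ℝ) ≤ C * Real.sqrt (1 + (k : ℝ) / (d : ℝ))) ∧
      (∃ ψ : Finset (Fin n) → GroupTesting.EGGTInput n k d → ℝ,
        QuantumQuery.DualAdversaryFeasible
          (GroupTesting.eggtOracle n k d) (GroupTesting.eggtAnswer n k d)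
          (fun S => Matrix.vecMulVec (ψ S) (ψ S)) ∧
        QuantumQuery.DualAdversaryObjectiveLE
          (fun S => Matrix.vecMulVec (ψ S) (ψ S))
          (C * Real.sqrt (1 + (k : ℝ) / (d : ℝ)))) := by
  -- 625 = 6 · 104 + 1, the 1 absorbing the rounding up of the number of queries.
  refine ⟨625, by norm_num, fun n k d _ hd => ?_⟩
  obtain ⟨ψ, hfeas, hobj⟩ := GroupTesting.exists_dualAdversary_solution n k d hd
  have hs : 1 ≤ √(1 + (k : ℝ) / d) := by
    rw [Real.one_le_sqrt]
    linarith [show (0 : ℝ) ≤ (k : ℝ) / d by positivity]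
  refine ⟨?_, ψ, hfeas, fun A => (hobj A).trans (by linarith)⟩
  have hpos : 0 < 6 * (104 * √(1 + (k : ℝ) / d)) := by linarith
  -- The empty query set always answers 0, so the oracle fixes the initial and answer states placed
  -- there.
  obtain ⟨𝒜, h𝒜, hq⟩ := QuantumQuery.exists_algorithm_of_dualAdversary _ _ ∅
    (fun A => by simp [GroupTesting.eggtOracle, GroupTesting.intersects]) ψ _ hfeas hobj
    ⌈6 * (104 * √(1 + (k : ℝ) / d))⌉₊ (Nat.ceil_pos.2 hpos) (Nat.le_ceil _)
  refine ⟨𝒜, h𝒜, ?_⟩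
  rw [hq]
  linarith [Nat.ceil_lt_add_one hpos.le]
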